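/- Write $\log$ for $\log_2$, $H(x)=-x\log x-(1-x)\log(1-x)$ and $D(q\|p)=q\log\frac{q}{p}+(1-q)\log\frac{1-q}{1-p}$ (with $0\log 0=0$). Fix $0<p\le 1/2$, $1/2\le s\le 1$ and $\epsilon>0$. For every $m$ let $n=n(m)$ be an integer with $n\ge(1+\epsilon)\,m\,(\log(1/p)+H(s))$. A hash function is a map $h:\{0,1\}^n\to\{0,1\}^m$; elements of $\{0,1\}^m$ are called bins, and the fractions of mappings of $h$ are $P_h(b)=2^{-n}\,|h^{-1}(b)|$. For every $m$ let $P_H$ be the fractions of mappings of some hash function such that $P_H$ represents drawing $m$ bits i.i.d. Bernoulli$(p)$, up to rounding of the numbers of mappings to integers: $\bigl|2^nP_H(b)-2^n\prod_{i=1}^m p^{b_i}(1-p)^{1-b_i}\bigr|<1$ for all $b$. A hash function with fractions of mappings $P_H$ is called a $P_H$-hash function, and the set of all of them is the $P_H$-set of hash functions. There are $M=\max(1,\lfloor 2^{H(s)m-1}\rfloor)$ users. To user $i$ allocate the $i$-th least likely bin $b_i$, $1\le i\le M$, i.e. $b_1,\dots,b_M$ are distinct, $P_H(b_1)\le\dots\le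 P_H(b_M)$, and every other bin $b$ has $P_H(b)\ge P_H(b_M)$ (ties are broken arbitrarily). The backdoor procedure then modifies the hash function $h$: the users independently draw passwords $g_1,\dots,g_M$ uniformly from $\{0,1\}^n$; every drawn password $g$ is remapped to $b_j$, where $j=\min\{i:g_i=g\}$, i.e. to the least likely bin among those allocated to the users who have drawn $g$, and this $b_j$ becomes the bin of each of these users; all other inputs keep their mappings. A strategy is an ordering of all inputs in $\{0,1\}^n$, which are guessed one by one in this order. The guesswork of a bin is the number of guesses until the first input that the modified hash function maps to this bin. Let $E(G_T(B))$ be the expected guesswork of the bin of a user chosen uniformly among the $M$ users, the expectation being over the user, over the passwords drawn in the backdoor procedure and, in addition, 1. for any $P_H$-hash function (fixed for every $m$): over a uniformly distributed strategy; 2. for the $P_H$-set of hash functions, and any strategy (fixed for every $m$): over a hash function drawn uniformly from the $P_H$-set. Then in both cases $$\lim_{m\to\infty}\frac1m\log E(G_T(B))=\begin{cases}H(s)+D(s\|p), & 1-p\le s\le 1,\\ 2H(p)+D(1-p\|p)-H(s), & 1/2\le s\le 1-p.\end{cases}$$ -/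

import Mathlib

open scoped BigOperators Topology

noncomputable section

namespace Guesswork

/-- Binary Shannon entropy, in bits. -/
def entropy (x : ℝ) : ℝ := Real.binEntropy x / Real.log 2

/-- Binary Kullback-Leibler divergence `D(q || p)`, in bits (for `0 < p < 1`, with `0 log 0 = 0`). -/
def divergence (q p : ℝ) : ℝ :=
  q * Real.logb 2 (q / p) + (1 - q) * Real.logb 2 ((1 - q) / (1 - p))

/-- The passwords: `n`-bit strings. -/
abbrev Input (n : ℕ) : Type := Fin n → Bool

/-- The bins: `m`-bit strings. -/
abbrev Bin (m : ℕ) : Type := Fin m → Bool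

/-- Hash functions from `n` bits to `m` bits. -/
abbrev HashFun (n m : ℕ) : Type := Input n → Bin m

/-- The fraction of mappings to each bin: the number of inputs mapped to `b`, divided by `2 ^ n`. -/
def fractions {n m : ℕ} (h : HashFun n m) (b : Bin m) : ℝ :=
  ((Finset.univ.filter fun x => h x = b).card : ℝ) / 2 ^ n

open Classical in
/-- The `P`-set of hash functions: all hash functions whose fractions of mappings are `P`. -/
def hashSet (n : ℕ) {m : ℕ} (P : Bin m → ℝ) : Finset (HashFun n m) :=
  Finset.univ.filter fun h => fractions h = P

/-- The probability of the `m`-bit string `b` when its bits are i.i.d. Bernoulli(`p`). -/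
def iidBernoulli (p : ℝ) {m : ℕ} (b : Bin m) : ℝ :=
  ∏ i, if b i then p else 1 - p

/-- `P` represents drawing `m` bits i.i.d. Bernoulli(`p`), among the fractions of mappings of hash
functions on `n`-bit inputs: some hash function has the fractions of mappings `P`, and the number
`2 ^ n * P b` of inputs mapped to `b` is `2 ^ n` times the probability of `b`, up to rounding to an
integer (hence equal to it whenever that product is an integer). -/
def RepresentsIIDBernoulli (n : ℕ) (p : ℝ) {m : ℕ} (P : Bin m → ℝ) : Prop :=
  (∃ h : HashFun n m, fractions h = P) ∧
    ∀ b, |2 ^ n * P b - 2 ^ n * iidBernoulli p b| < 1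

/-- The number of users: `2 ^ (H(s) m - 1)`, rounded down to an integer, and at least one. -/
def numUsers (s : ℝ) (m : ℕ) : ℕ :=
  max 1 ⌊(2 : ℝ) ^ (entropy s * m - 1)⌋₊

/-- `β` allocates different bins to the `M` users, in the order of the fractions of mappings `P`:
the least likely bin to the first user, and so on to the `M`-th least likely bin, ties being broken
in any way. -/
def IsLeastLikelyAllocation {m M : ℕ} (P : Bin m → ℝ) (β : Fin M → Bin m) : Prop :=
  Function.Injective β ∧ (∀ i j, i ≤ j → P (β i) ≤ P (β j)) ∧
    ∀ i, ∀ b ∉ Set.range β, P (β i) ≤ P b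

/-- Among the users who have drawn the password `x`, the one with the least likely allocated bin,
that is, the first one. -/
def firstUser {n M : ℕ} (g : Fin M → Input n) (x : Input n) (hx : ∃ i, g i = x) : Fin M :=
  (Finset.univ.filter fun i => g i = x).min' (by
    obtain ⟨i, hi⟩ := hx
    exact ⟨i, by simp [hi]⟩)

/-- The hash function after the backdoor procedure, when user `i` has drawn the password `g i`:
each drawn password is remapped, once, to the least likely bin among those allocated to the users
who have drawn it; the other inputs keep their mappings. -/
def backdoorHash {n m M : ℕ} (h : HashFun n m) (β : Fin M → Bin m) (g : Fin M → Input n) :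
    HashFun n m := by
  classical
  exact fun x => if hx : ∃ i, g i = x then β (firstUser g x hx) else h x

/-- The bin of user `i` after the backdoor procedure. -/
def userBin {n m M : ℕ} (β : Fin M → Bin m) (g : Fin M → Input n) (i : Fin M) : Bin m :=
  β (firstUser g (g i) ⟨i, rfl⟩)

/-- A strategy of guessing passwords one by one: an ordering of the inputs, `σ k` being the guess
number `k + 1`. -/
abbrev Strategy (n : ℕ) : Type := Fin (2 ^ n) ≃ Input n

/-- The guesswork of bin `b`: the number of guesses until the first password mapped to `b`.
(It is only applied to bins of the users, to each of which some input is mapped.) -/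
def guesswork {n m : ℕ} (h : HashFun n m) (σ : Strategy n) (b : Bin m) : ℕ :=
  sInf {t : ℕ | ∃ k : Fin (2 ^ n), t = (k : ℕ) + 1 ∧ h (σ k) = b}

/-- The guesswork for a uniformly chosen user, when the backdoor procedure has been carried out with
uniformly drawn passwords: its average over the users and over the passwords. -/
def usersGuesswork {n m M : ℕ} (h : HashFun n m) (β : Fin M → Bin m) (σ : Strategy n) : ℝ :=
  𝔼 g : Fin M → Input n, 𝔼 i : Fin M,
    (guesswork (backdoorHash h β g) σ (userBin β g i) : ℝ)

/-- The average guesswork across users of the hash function `h`, averaged uniformly over all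
strategies. -/
def averageOverStrategies {n m M : ℕ} (h : HashFun n m) (β : Fin M → Bin m) : ℝ :=
  𝔼 σ : Strategy n, usersGuesswork h β σ

/-- The average guesswork across users of the `P`-set of hash functions, averaged uniformly over the
set, for the strategy `σ`. -/
def averageOverHashSet {n m M : ℕ} (P : Bin m → ℝ) (β : Fin M → Bin m) (σ : Strategy n) : ℝ :=
  𝔼 h ∈ hashSet n P, usersGuesswork h β σ

/-- The growth rate claimed for the average guesswork (the two expressions agree at `s = 1 - p`). -/
def onlineRate (p s : ℝ) : ℝ :=
  if 1 - p ≤ s then entropy s + divergence s p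
  else 2 * entropy p + divergence (1 - p) p - entropy s

end Guesswork

end

namespace Guesswork

open Finset

/-! Under a uniformly random ordering, a bin with `c` preimages among `2 ^ n` inputs has expected
guesswork `(2 ^ n + 1) / (c + 1)`. The lower bound on `n` makes every fibre so large that remapping
at most `M` inputs changes its size by at most a constant factor. A collision of passwords moves a
user only to a less likely bin, and its expected extra cost is at most 1. So the average guesswork
lies between constant multiples of the average of `1 / P (β i)` over the users
(`averageOverStrategies_mem_Icc`). Permuting inputs preserves the `P`-set, so its average does not
depend on the strategy and has the same bounds (`averageOverHashSet_eq`).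

It remains to find the exponent of that average. About `exp (m H(t))` bins have a fraction `t` of
ones (entropy in nats), each contributing about `exp (m (-t log p - (1 - t) log (1 - p)))`. The
exponent of the product peaks at `t = 1 - p`, and the `M` least likely bins are roughly those with
fraction at least `s`; hence `t = max s (1 - p)` dominates. The upper bound (`expect_inv_le`)
compares inverse Bernoulli(`p`) probabilities with probabilities of Bernoulli(`1 - p`) or
Bernoulli(`s`); the lower bound (`le_expect_inv`) counts bins typical for Bernoulli(`t`). Dividing
by `M ≈ exp (m H(s))` gives `natRate`. -/

/-! ### Expected guesswork under a random ordering -/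

/-- Among the orderings of a finite type, each element of `B` is the first one of `B` equally
often. -/
theorem card_mul_card_first {α : Type*} [Fintype α] [DecidableEq α] {N : ℕ}
    (B : Finset α) {x : α} (hx : x ∈ B) :
    B.card * (univ.filter fun σ : Fin N ≃ α => ∀ y ∈ B, σ.symm x ≤ σ.symm y).card =
      Fintype.card (Fin N ≃ α) := by
  have hsymm : ∀ z ∈ B, (univ.filter fun σ : Fin N ≃ α => ∀ y ∈ B, σ.symm z ≤ σ.symm y).card =
      (univ.filter fun σ : Fin N ≃ α => ∀ y ∈ B, σ.symm x ≤ σ.symm y).card := by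
    intro z hz
    have hB : ∀ y, y ∈ B → Equiv.swap x z y ∈ B := by
      intro y hy
      by_cases h1 : y = x
      · subst h1; simpa using hz
      · by_cases h2 : y = z
        · subst h2; simpa using hx
        · rwa [Equiv.swap_apply_of_ne_of_ne h1 h2]
    refine card_bij' (fun σ _ => σ.trans (Equiv.swap x z)) (fun σ _ => σ.trans (Equiv.swap x z))
      ?_ ?_ ?_ ?_
    · intro σ hσ
      simp only [mem_filter, mem_univ, true_and, Equiv.symm_trans_apply, Equiv.symm_swap,
        Equiv.swap_apply_left] at hσ ⊢
      exact fun y hy => hσ _ (hB y hy)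
    · intro σ hσ
      simp only [mem_filter, mem_univ, true_and, Equiv.symm_trans_apply, Equiv.symm_swap,
        Equiv.swap_apply_right] at hσ ⊢
      exact fun y hy => hσ _ (hB y hy)
    · intro σ _; ext; simp
    · intro σ _; ext; simp
  -- Each ordering has exactly one first element of `B`, so double counting finishes the proof.
  have hone : ∀ σ : Fin N ≃ α, (B.filter fun z => ∀ y ∈ B, σ.symm z ≤ σ.symm y).card = 1 := by
    intro σ
    obtain ⟨z, hz, hmin⟩ := exists_min_image B σ.symm ⟨x, hx⟩
    rw [card_eq_one]
    refine ⟨z, ?_⟩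
    ext w
    simp only [mem_filter, mem_singleton]
    constructor
    · rintro ⟨hw, hw'⟩
      exact σ.symm.injective (le_antisymm (hw' z hz) (hmin w hw))
    · rintro rfl
      exact ⟨hz, hmin⟩
  calc B.card * _ = ∑ z ∈ B,
        (univ.filter fun σ : Fin N ≃ α => ∀ y ∈ B, σ.symm z ≤ σ.symm y).card := by
        rw [sum_congr rfl hsymm, sum_const, smul_eq_mul]
    _ = ∑ σ : Fin N ≃ α, (B.filter fun z => ∀ y ∈ B, σ.symm z ≤ σ.symm y).card :=
        sum_card_bipartiteAbove_eq_sum_card_bipartiteBelow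
          (fun z (σ : Fin N ≃ α) => ∀ y ∈ B, σ.symm z ≤ σ.symm y)
    _ = Fintype.card (Fin N ≃ α) := by simp [hone]

/-- The guesswork counts the inputs that come no later than the first one mapped to `b`. -/
theorem guesswork_eq_card {n m : ℕ} (h : HashFun n m) (σ : Strategy n) (b : Bin m)
    (hb : ∃ x, h x = b) :
    guesswork h σ b =
      (univ.filter fun x => ∀ y ∈ univ.filter fun y => h y = b, σ.symm x ≤ σ.symm y).card := by
  obtain ⟨x₀, hx₀⟩ := hb
  obtain ⟨z, hz, hmin⟩ := exists_min_image (univ.filter fun y => h y = b) σ.symm ⟨x₀, by simp [hx₀]⟩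
  simp only [mem_filter, mem_univ, true_and] at hz hmin
  have hcard : (univ.filter fun x => ∀ y ∈ univ.filter fun y => h y = b,
      σ.symm x ≤ σ.symm y).card = (σ.symm z : ℕ) + 1 := by
    rw [← Fin.card_Iic, ← card_map σ.toEmbedding]
    congr 1
    ext x
    simp only [mem_filter, mem_univ, true_and, mem_map_equiv, mem_Iic]
    exact ⟨fun hx => hx z hz, fun hx y hy => hx.trans (hmin y hy)⟩
  rw [hcard]
  apply le_antisymm
  · exact Nat.sInf_le ⟨σ.symm z, rfl, by simpa using hz⟩
  · refine le_csInf ⟨_, σ.symm z, rfl, by simpa using hz⟩ ?_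
    rintro t ⟨k, rfl, hk⟩
    have := hmin (σ k) hk
    rw [Equiv.symm_apply_apply] at this
    have : (σ.symm z : ℕ) ≤ k := this
    omega

theorem card_input (n : ℕ) : Fintype.card (Input n) = 2 ^ n := by simp

instance (n : ℕ) : Nonempty (Strategy n) :=
  ⟨(Fintype.equivFinOfCardEq (card_input n)).symm⟩

/-- The expected guesswork of a bin to which `c` inputs are mapped, over a uniformly distributed
strategy, is `(2 ^ n + 1) / (c + 1)`. -/
theorem expect_guesswork {n m : ℕ} (h : HashFun n m) (b : Bin m) (hb : ∃ x, h x = b) :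
    𝔼 σ : Strategy n, (guesswork h σ b : ℝ) =
      (2 ^ n + 1) / ((univ.filter fun x => h x = b).card + 1) := by
  set A := univ.filter fun x => h x = b with hA
  have hApos : 0 < A.card := card_pos.mpr (by obtain ⟨x, hx⟩ := hb; exact ⟨x, by simp [hA, hx]⟩)
  have hAle : A.card ≤ 2 ^ n := by rw [← card_input n]; exact card_le_univ A
  set K : ℝ := (Fintype.card (Strategy n) : ℝ) with hK
  have hKpos : 0 < K := by rw [hK]; exact_mod_cast Fintype.card_pos
  have hin : ∀ x ∈ A, ((univ.filter fun σ : Strategy n =>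
      ∀ y ∈ A, σ.symm x ≤ σ.symm y).card : ℝ) = K / A.card := by
    intro x hx
    rw [eq_div_iff (by positivity), mul_comm, hK]
    exact_mod_cast card_mul_card_first A hx
  -- An input outside `A` precedes all of `A` exactly when it is the first element of `insert x A`.
  have hout : ∀ x ∈ univ \ A, ((univ.filter fun σ : Strategy n =>
      ∀ y ∈ A, σ.symm x ≤ σ.symm y).card : ℝ) = K / (A.card + 1) := by
    intro x hx
    have hxA : x ∉ A := by simpa using hx
    have := card_mul_card_first (N := 2 ^ n) (insert x A) (mem_insert_self x A)
    rw [card_insert_of_notMem hxA] at this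
    simp only [forall_mem_insert, le_refl, true_and] at this
    rw [eq_div_iff (by positivity), mul_comm, hK]
    exact_mod_cast this
  have hsum : ∑ σ : Strategy n, (guesswork h σ b : ℝ) =
      ∑ x : Input n, ((univ.filter fun σ : Strategy n =>
        ∀ y ∈ A, σ.symm x ≤ σ.symm y).card : ℝ) := by
    have := sum_card_bipartiteAbove_eq_sum_card_bipartiteBelow
      (s := (univ : Finset (Input n))) (t := (univ : Finset (Strategy n)))
      (fun x σ => ∀ y ∈ A, σ.symm x ≤ σ.symm y)
    simp only [bipartiteAbove, bipartiteBelow] at this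
    rw [← Nat.cast_sum (R := ℝ) univ fun x => (univ.filter fun σ : Strategy n =>
        ∀ y ∈ A, σ.symm x ≤ σ.symm y).card, this, Nat.cast_sum]
    exact sum_congr rfl fun σ _ => by rw [guesswork_eq_card h σ b hb]
  have hc : ((univ \ A).card : ℝ) = 2 ^ n - A.card := by
    rw [card_sdiff_of_subset (subset_univ _), card_univ, card_input, Nat.cast_sub hAle]
    simp
  rw [Fintype.expect_eq_sum_div_card, hsum, ← sum_sdiff (subset_univ A), sum_congr rfl hout,
    sum_congr rfl hin, sum_const, sum_const, nsmul_eq_mul, nsmul_eq_mul, hc, ← hK]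
  have : (0 : ℝ) < A.card := by exact_mod_cast hApos
  field_simp
  ring

/-! ### Effect of the backdoor procedure -/

theorem backdoorHash_apply_password {n m M : ℕ} (h : HashFun n m) (β : Fin M → Bin m)
    (g : Fin M → Input n) (i : Fin M) : backdoorHash h β g (g i) = userBin β g i := by
  have : ∃ j, g j = g i := ⟨i, rfl⟩
  simp [backdoorHash, userBin, this]

theorem backdoorHash_apply_of_notMem {n m M : ℕ} (h : HashFun n m) (β : Fin M → Bin m)
    (g : Fin M → Input n) {x : Input n} (hx : x ∉ univ.image g) : backdoorHash h β g x = h x := by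
  have : ¬ ∃ j, g j = x := by simpa using hx
  simp only [backdoorHash, this, dite_false]

theorem card_fiber_le_of_eqOn {α γ : Type*} [Fintype α] [DecidableEq α] [DecidableEq γ]
    (h h' : α → γ) (R : Finset α) (hR : ∀ x ∉ R, h x = h' x) (b : γ) :
    (univ.filter fun x => h x = b).card ≤ (univ.filter fun x => h' x = b).card + R.card := by
  refine (card_le_card fun x hx => ?_).trans (card_union_le _ R)
  by_cases hxR : x ∈ R
  · exact mem_union_right _ hxR
  · refine mem_union_left _ ?_
    simpa [← hR x hxR] using hx

theorem card_image_passwords_le {n M : ℕ} (g : Fin M → Input n) : (univ.image g).card ≤ M :=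
  card_image_le.trans (by simp)

theorem firstUser_le {n M : ℕ} (g : Fin M → Input n) (i : Fin M) :
    firstUser g (g i) ⟨i, rfl⟩ ≤ i :=
  min'_le _ _ (by simp)

theorem apply_firstUser {n M : ℕ} (g : Fin M → Input n) (i : Fin M) :
    g (firstUser g (g i) ⟨i, rfl⟩) = g i :=
  (mem_filter.mp (min'_mem (univ.filter fun j => g j = g i) ⟨i, by simp⟩)).2

theorem averageOverStrategies_eq {n m M : ℕ} (h : HashFun n m) (β : Fin M → Bin m) :
    averageOverStrategies h β = 𝔼 g : Fin M → Input n, 𝔼 i : Fin M,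
      (2 ^ n + 1 : ℝ) /
        ((univ.filter fun x => backdoorHash h β g x = userBin β g i).card + 1) := by
  unfold averageOverStrategies usersGuesswork
  rw [expect_comm]
  refine expect_congr rfl fun g _ => ?_
  rw [expect_comm]
  exact expect_congr rfl fun i _ =>
    expect_guesswork _ _ ⟨g i, backdoorHash_apply_password h β g i⟩

theorem card_fiber_eq {n m : ℕ} {h : HashFun n m} {P : Bin m → ℝ} (hh : fractions h = P)
    (b : Bin m) : ((univ.filter fun x => h x = b).card : ℝ) = 2 ^ n * P b := by
  rw [← hh, fractions]
  field_simp

/-- Collisions only lower `P` at the user's bin, because the first user among those sharing a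
password has the least likely bin. A fibre gains at most `M` inputs, which at most doubles the
denominator. -/
theorem le_averageOverStrategies {n m M : ℕ} {h : HashFun n m} {P : Bin m → ℝ}
    (hh : fractions h = P) {β : Fin M → Bin m} (hβ : IsLeastLikelyAllocation P β)
    (hM : ∀ b, 2 * (M + 1 : ℝ) ≤ 2 ^ n * P b) :
    (1 / 2) * 𝔼 i : Fin M, (P (β i))⁻¹ ≤ averageOverStrategies h β := by
  have hN : (0 : ℝ) < 2 ^ n := by positivity
  have hP : ∀ b, 0 < P b := fun b => pos_of_mul_pos_right (lt_of_lt_of_le (by positivity) (hM b)) hN.le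
  rw [averageOverStrategies_eq, ← Fintype.expect_const (ι := Fin M → Input n) ((1 / 2) * _)]
  refine expect_le_expect fun g _ => ?_
  rw [mul_expect]
  refine expect_le_expect fun i _ => ?_
  set j := firstUser g (g i) ⟨i, rfl⟩ with hj
  have hji : P (β j) ≤ P (β i) := hβ.2.1 _ _ (firstUser_le g i)
  have hle : ((univ.filter fun x => backdoorHash h β g x = β j).card : ℝ) ≤
      2 ^ n * P (β j) + M := by
    rw [← card_fiber_eq hh]
    exact_mod_cast (card_fiber_le_of_eqOn _ h (univ.image g)
      (fun x hx => backdoorHash_apply_of_notMem h β g hx) (β j)).trans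
        (Nat.add_le_add_left (card_image_passwords_le g) _)
  have hM' := hM (β j)
  calc 1 / 2 * (P (β i))⁻¹ ≤ 1 / 2 * (P (β j))⁻¹ := by
        gcongr
        exact hP _
    _ = 2 ^ n / (2 * (2 ^ n * P (β j))) := by
        have := (hP (β j)).ne'
        field_simp
    _ ≤ _ := by
        change _ ≤ (2 ^ n + 1 : ℝ) / ((univ.filter fun x => backdoorHash h β g x = β j).card + 1)
        gcongr
        · linarith
        · nlinarith [(M.cast_nonneg : (0 : ℝ) ≤ M)]

/-- When `g i = g j`, the other coordinates determine `g i`. -/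
theorem expect_apply_eq_apply_le {n M : ℕ} {i j : Fin M} (hij : i ≠ j) :
    𝔼 g : Fin M → Input n, (if g i = g j then 1 else 0 : ℝ) ≤ (2 ^ n)⁻¹ := by
  have hcard : (univ.filter fun g : Fin M → Input n => g i = g j).card ≤ (2 ^ n) ^ (M - 1) := by
    have : Fintype.card ({k // k ≠ i} → Input n) = (2 ^ n) ^ (M - 1) := by
      simp [Fintype.card_subtype_compl]
    rw [← this, ← card_univ]
    refine card_le_card_of_injOn (fun g k => g k) (fun _ _ => mem_coe.mpr (mem_univ _)) ?_
    intro g hg g' hg' hgg'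
    simp only [coe_filter, mem_univ, true_and, Set.mem_ofPred_eq] at hg hg'
    have hne : ∀ k, k ≠ i → g k = g' k := fun k hk => congrFun hgg' ⟨k, hk⟩
    funext k
    by_cases hk : k = i
    · rw [hk, hg, hg', hne j hij.symm]
    · exact hne k hk
  have hM : M = (M - 1) + 1 := by have := i.pos; omega
  have htot : (Fintype.card (Fin M → Input n) : ℝ) = (2 ^ n) ^ (M - 1) * 2 ^ n := by
    rw [← pow_succ, ← hM]
    simp
  rw [Fintype.expect_eq_sum_div_card, sum_boole, htot, div_le_iff₀ (by positivity),
    mul_comm, mul_assoc, mul_inv_cancel₀ (by positivity), mul_one]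
  exact_mod_cast hcard

/-- A fibre loses at most `M` inputs, less than half of it; this costs a factor 2. Collisions add at
most 1 in expectation, and `1 ≤ 1 / P (β i)` turns this into the third multiple. -/
theorem averageOverStrategies_le {n m M : ℕ} [NeZero M] {h : HashFun n m} {P : Bin m → ℝ}
    (hh : fractions h = P) {β : Fin M → Bin m}
    (hM : ∀ b, 2 * (M + 1 : ℝ) ≤ 2 ^ n * P b) :
    averageOverStrategies h β ≤ 3 * 𝔼 i : Fin M, (P (β i))⁻¹ := by
  have hN : (0 : ℝ) < 2 ^ n := by positivity
  have hP : ∀ b, 0 < P b := fun b => pos_of_mul_pos_right (lt_of_lt_of_le (by positivity) (hM b)) hN.le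
  have hP1 : ∀ b, P b ≤ 1 := fun b => by
    have : (univ.filter fun x => h x = b).card ≤ 2 ^ n := by
      rw [← card_input n]; exact card_le_univ _
    rw [← hh, fractions, div_le_one hN]
    exact_mod_cast this
  -- Union bound: either user `i` keeps the bin `β i`, or the first user `j` with the same password
  -- supplies one term of the sum.
  have hpt : ∀ (g : Fin M → Input n) (i : Fin M), (2 ^ n + 1 : ℝ) /
      ((univ.filter fun x => backdoorHash h β g x = userBin β g i).card + 1) ≤
        2 * (P (β i))⁻¹ + ∑ j ∈ univ.erase i, (if g i = g j then 1 else 0) * (2 * (P (β j))⁻¹) := by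
    intro g i
    set j := firstUser g (g i) ⟨i, rfl⟩ with hj
    have hge : 2 ^ n * P (β j) - M ≤
        ((univ.filter fun x => backdoorHash h β g x = β j).card : ℝ) := by
      rw [← card_fiber_eq hh, sub_le_iff_le_add]
      exact_mod_cast (card_fiber_le_of_eqOn h _ (univ.image g)
        (fun x hx => (backdoorHash_apply_of_notMem h β g hx).symm) (β j)).trans
          (Nat.add_le_add_left (card_image_passwords_le g) _)
    have h1 : (2 ^ n + 1 : ℝ) /
        ((univ.filter fun x => backdoorHash h β g x = userBin β g i).card + 1) ≤
          2 * (P (β j))⁻¹ := by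
      change (2 ^ n + 1 : ℝ) /
        ((univ.filter fun x => backdoorHash h β g x = β j).card + 1) ≤ _
      have hM' := hM (β j)
      rw [← div_eq_mul_inv, div_le_div_iff₀ (by positivity) (hP _)]
      nlinarith [hP1 (β j)]
    refine h1.trans ?_
    have hnn : ∀ k ∈ univ.erase i,
        0 ≤ (if g i = g k then 1 else 0) * (2 * (P (β k))⁻¹) := fun k _ => by
      have := (hP (β k)).le
      positivity
    by_cases hji : j = i
    · rw [hji]
      linarith [sum_nonneg hnn]
    · have h2 := single_le_sum hnn (mem_erase.mpr ⟨hji, mem_univ j⟩)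
      rw [if_pos (apply_firstUser g i).symm, one_mul] at h2
      have := inv_nonneg.mpr (hP (β i)).le
      linarith
  rw [averageOverStrategies_eq, expect_comm, mul_expect]
  refine expect_le_expect fun i _ => ?_
  refine (expect_le_expect fun g _ => hpt g i).trans ?_
  rw [expect_add_distrib, Fintype.expect_const, expect_sum_comm]
  -- The collision probability `2⁻ⁿ` times `2 / P (β j)` is at most `1 / M`, since `2 ^ n * P (β j)`
  -- is at least `2 (M + 1)`.
  have h3 : ∀ j ∈ univ.erase i, 𝔼 g : Fin M → Input n,
      (if g i = g j then 1 else 0 : ℝ) * (2 * (P (β j))⁻¹) ≤ (M : ℝ)⁻¹ := by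
    intro j hj
    have hMpos : (0 : ℝ) < M := by exact_mod_cast NeZero.pos M
    have := hM (β j)
    have := hP (β j)
    rw [← expect_mul]
    refine (mul_le_mul_of_nonneg_right (expect_apply_eq_apply_le (ne_of_mem_erase hj).symm)
      (by positivity)).trans ?_
    rw [← one_div, ← one_div, ← one_div, mul_one_div, div_mul_div_comm,
      div_le_div_iff₀ (by positivity) hMpos]
    linarith
  have h4 := sum_le_card_nsmul _ _ _ h3
  have hMpos : (0 : ℝ) < M := by exact_mod_cast NeZero.pos M
  have h5 : ((univ.erase i).card • (M : ℝ)⁻¹) ≤ 1 := by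
    rw [nsmul_eq_mul, ← div_eq_mul_inv, div_le_one hMpos]
    exact_mod_cast (card_le_univ _).trans (by simp)
  have h6 : 1 ≤ (P (β i))⁻¹ := (one_le_inv₀ (hP _)).mpr (hP1 _)
  linarith

/-! ### Symmetry between hash functions and strategies -/

theorem fractions_comp {n m : ℕ} (h : HashFun n m) (π : Equiv.Perm (Input n)) :
    fractions (fun x => h (π x)) = fractions h := by
  funext b
  unfold fractions
  congr 2
  exact card_equiv π (by simp)

theorem guesswork_comp {n m : ℕ} (h : HashFun n m) (σ : Strategy n) (π : Equiv.Perm (Input n))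
    (b : Bin m) : guesswork (fun x => h (π x)) σ b = guesswork h (σ.trans π) b := rfl

theorem firstUser_congr {n M : ℕ} (g g' : Fin M → Input n) {x x' : Input n}
    (hx : ∃ i, g i = x) (hx' : ∃ i, g' i = x') (hg : ∀ i, g i = x ↔ g' i = x') :
    firstUser g x hx = firstUser g' x' hx' := by
  unfold firstUser
  congr 1
  exact filter_congr fun i _ => hg i

theorem backdoorHash_comp {n m M : ℕ} (h : HashFun n m) (β : Fin M → Bin m) (g : Fin M → Input n)
    (π : Equiv.Perm (Input n)) :
    backdoorHash (fun x => h (π x)) β g =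
      fun x => backdoorHash h β (fun i => π (g i)) (π x) := by
  funext x
  simp only [backdoorHash, EmbeddingLike.apply_eq_iff_eq]
  split_ifs with hx
  · exact congrArg β (firstUser_congr _ _ _ _ (by simp))
  · rfl

theorem userBin_comp {n m M : ℕ} (β : Fin M → Bin m) (g : Fin M → Input n)
    (π : Equiv.Perm (Input n)) (i : Fin M) :
    userBin β (fun i => π (g i)) i = userBin β g i :=
  congrArg β (firstUser_congr _ _ _ _ (by simp))

/-- Renaming the inputs of the hash function amounts to renaming the guesses. -/
theorem usersGuesswork_comp {n m M : ℕ} (h : HashFun n m) (β : Fin M → Bin m) (σ : Strategy n)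
    (π : Equiv.Perm (Input n)) :
    usersGuesswork (fun x => h (π x)) β σ = usersGuesswork h β (σ.trans π) := by
  unfold usersGuesswork
  refine Fintype.expect_equiv (Equiv.piCongrRight fun _ => π) _ _ fun g => ?_
  refine expect_congr rfl fun i _ => ?_
  rw [backdoorHash_comp, guesswork_comp]
  change _ = (guesswork (backdoorHash h β fun i => π (g i)) _ (userBin β (fun i => π (g i)) i) : ℝ)
  rw [userBin_comp]

/-- Averaging over the set of hash functions makes all strategies equivalent. -/
theorem averageOverHashSet_eq {n m M : ℕ} (P : Bin m → ℝ) (β : Fin M → Bin m) (σ : Strategy n) :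
    averageOverHashSet P β σ = 𝔼 h ∈ hashSet n P, averageOverStrategies h β := by
  -- The permutation `σ.symm.trans τ` of the inputs carries `σ` to `τ` and preserves the `P`-set.
  have key : ∀ τ : Strategy n, averageOverHashSet P β τ = averageOverHashSet P β σ := by
    intro τ
    unfold averageOverHashSet
    refine expect_equiv ((σ.symm.trans τ).symm.arrowCongr (Equiv.refl _)) ?_ ?_
    · intro h
      simp only [hashSet, mem_filter, mem_univ, true_and]
      rw [← fractions_comp h (σ.symm.trans τ)]
      rfl
    · intro h _
      have := usersGuesswork_comp h β σ (σ.symm.trans τ)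
      rw [← Equiv.trans_assoc, Equiv.self_trans_symm, Equiv.refl_trans] at this
      exact this.symm
  unfold averageOverStrategies
  rw [expect_comm, ← Fintype.expect_const (ι := Strategy n) (averageOverHashSet P β σ)]
  exact expect_congr rfl fun τ _ => (key τ).symm

theorem averageOverHashSet_mem_Icc {n m M : ℕ} {P : Bin m → ℝ} {β : Fin M → Bin m}
    (hP : ∃ h : HashFun n m, fractions h = P) {a b : ℝ}
    (hab : ∀ h : HashFun n m, fractions h = P → averageOverStrategies h β ∈ Set.Icc a b)
    (σ : Strategy n) : averageOverHashSet P β σ ∈ Set.Icc a b := by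
  have hne : (hashSet n P).Nonempty := by
    obtain ⟨h, hh⟩ := hP
    exact ⟨h, by simp [hashSet, hh]⟩
  have hmem : ∀ h ∈ hashSet n P, fractions h = P := fun h hh => by simpa [hashSet] using hh
  rw [averageOverHashSet_eq]
  exact ⟨le_expect hne fun h hh => (hab h (hmem h hh)).1,
    expect_le hne fun h hh => (hab h (hmem h hh)).2⟩

/-! ### Weights of bins and Bernoulli probabilities -/

/-- The number of ones of a bin. -/
abbrev weight {m : ℕ} (b : Bin m) : ℕ := (univ.filter fun i => b i = true).card

theorem weight_le {m : ℕ} (b : Bin m) : weight b ≤ m :=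
  (card_le_univ _).trans (by simp)

theorem iidBernoulli_eq_pow (p : ℝ) {m : ℕ} (b : Bin m) :
    iidBernoulli p b = p ^ weight b * (1 - p) ^ (m - weight b) := by
  have h : (univ.filter fun i => ¬ b i = true).card = m - weight b := by
    have := card_filter_add_card_filter_not (s := (univ : Finset (Fin m))) (fun i => b i = true)
    rw [card_univ, Fintype.card_fin] at this
    unfold weight
    omega
  rw [iidBernoulli, prod_ite, prod_const, prod_const, h]

theorem iidBernoulli_nonneg {p : ℝ} (hp0 : 0 ≤ p) (hp1 : p ≤ 1) {m : ℕ} (b : Bin m) :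
    0 ≤ iidBernoulli p b := by
  rw [iidBernoulli_eq_pow]
  have : 0 ≤ 1 - p := by linarith
  positivity

/-- The reference fraction `t` is free: the exponent is split into its value at weight `t * m` and a
linear deviation. -/
theorem iidBernoulli_eq_exp {p : ℝ} (hp0 : 0 < p) (hp1 : p < 1) {m : ℕ} (b : Bin m) (t : ℝ) :
    iidBernoulli p b = Real.exp (m * (t * Real.log p + (1 - t) * Real.log (1 - p)) +
      (weight b - t * m) * (Real.log p - Real.log (1 - p))) := by
  have h1p : 0 < 1 - p := by linarith
  have hpow : ∀ {x : ℝ} (k : ℕ), 0 < x → x ^ k = Real.exp (k * Real.log x) := fun k hx => by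
    rw [Real.exp_nat_mul, Real.exp_log hx]
  rw [iidBernoulli_eq_pow, hpow _ hp0, hpow _ h1p, ← Real.exp_add, Nat.cast_sub (weight_le b)]
  congr 1
  ring

theorem sum_weight {m : ℕ} (F : ℕ → ℝ) :
    ∑ b : Bin m, F (weight b) = ∑ k ∈ range (m + 1), (m.choose k : ℝ) * F k := by
  have h : ∑ b : Bin m, F (weight b) = ∑ s : Finset (Fin m), F s.card := by
    refine sum_bij' (fun b _ => univ.filter fun i => b i = true) (fun s _ i => decide (i ∈ s))
      ?_ ?_ ?_ ?_ ?_ <;> simp [weight]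
  rw [h, ← powerset_univ, sum_powerset_apply_card, card_univ, Fintype.card_fin]
  simp [nsmul_eq_mul]

theorem sum_iidBernoulli (t : ℝ) (m : ℕ) : ∑ b : Bin m, iidBernoulli t b = 1 := by
  simp_rw [iidBernoulli_eq_pow]
  rw [sum_weight (fun k => t ^ k * (1 - t) ^ (m - k))]
  have := congrArg (Polynomial.eval t) (bernsteinPolynomial.sum ℝ m)
  simpa [Polynomial.eval_finsetSum, bernsteinPolynomial, mul_assoc] using this

theorem variance_weight (t : ℝ) (m : ℕ) :
    ∑ b : Bin m, ((weight b : ℝ) - t * m) ^ 2 * iidBernoulli t b = m * t * (1 - t) := by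
  simp_rw [iidBernoulli_eq_pow]
  rw [sum_weight (fun k => ((k : ℝ) - t * m) ^ 2 * (t ^ k * (1 - t) ^ (m - k)))]
  have := congrArg (Polynomial.eval t) (bernsteinPolynomial.variance ℝ m)
  simp only [Polynomial.eval_finsetSum, bernsteinPolynomial, nsmul_eq_mul, Polynomial.eval_mul,
    Polynomial.eval_pow, Polynomial.eval_sub, Polynomial.eval_natCast, Polynomial.eval_X,
    Polynomial.eval_one] at this
  rw [← this]
  exact sum_congr rfl fun k _ => by ring

theorem binEntropy_eq (t : ℝ) :
    Real.binEntropy t = -(t * Real.log t) - (1 - t) * Real.log (1 - t) := by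
  rw [Real.binEntropy, Real.log_inv, Real.log_inv]
  ring

/-- The bins with a fraction of ones within `δ` of `t`. -/
noncomputable def typicalBins (m : ℕ) (t δ : ℝ) : Finset (Bin m) :=
  univ.filter fun b => |(weight b : ℝ) - t * m| ≤ δ * m

/-- Chebyshev's inequality, with variance at most `m / 4`. -/
theorem half_le_sum_typicalBins {m : ℕ} {t δ : ℝ} (ht0 : 0 ≤ t) (ht1 : t ≤ 1) (hδ : 0 < δ)
    (hm : 1 ≤ 2 * δ ^ 2 * m) : 1 / 2 ≤ ∑ b ∈ typicalBins m t δ, iidBernoulli t b := by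
  have hm0 : (0 : ℝ) < m := pos_of_mul_pos_right (lt_of_lt_of_le one_pos hm) (by positivity)
  have hsplit := sum_filter_add_sum_filter_not univ
    (fun b : Bin m => |(weight b : ℝ) - t * m| ≤ δ * m) (fun b => iidBernoulli t b)
  rw [sum_iidBernoulli] at hsplit
  have hcheb : (δ * m) ^ 2 * ∑ b ∈ univ.filter (fun b : Bin m =>
      ¬ |(weight b : ℝ) - t * m| ≤ δ * m), iidBernoulli t b ≤ m * t * (1 - t) := by
    rw [← variance_weight, mul_sum]
    refine (sum_le_sum fun b hb => ?_).trans
      (sum_le_sum_of_subset_of_nonneg (filter_subset _ _) fun b _ _ =>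
        mul_nonneg (sq_nonneg _) (iidBernoulli_nonneg ht0 ht1 b))
    refine mul_le_mul_of_nonneg_right ?_ (iidBernoulli_nonneg ht0 ht1 b)
    rw [← sq_abs ((weight b : ℝ) - t * m)]
    have := (mem_filter.mp hb).2
    gcongr
    linarith
  set X := ∑ b ∈ univ.filter (fun b : Bin m => ¬ |(weight b : ℝ) - t * m| ≤ δ * m),
    iidBernoulli t b
  have hX : 0 ≤ X := sum_nonneg fun b _ => iidBernoulli_nonneg ht0 ht1 b
  have h1 : δ ^ 2 * m * X ≤ 1 / 4 := by
    have h2 : (m : ℝ) * (δ ^ 2 * m * X) ≤ m * (1 / 4) := by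
      nlinarith [sq_nonneg (2 * t - 1)]
    exact le_of_mul_le_mul_left h2 hm0
  have h3 : X ≤ 1 / 2 := by nlinarith
  change 1 / 2 ≤ ∑ b ∈ univ.filter (fun b : Bin m => |(weight b : ℝ) - t * m| ≤ δ * m), _
  linarith

/-- Typical bins carry Bernoulli(`t`) mass at least 1/2, while each has probability at most the
inverse of the exponential. -/
theorem le_card_typicalBins {m : ℕ} {t δ : ℝ} (ht0 : 1 / 2 ≤ t) (ht1 : t ≤ 1) (hδ : 0 < δ)
    (hm : 1 ≤ 2 * δ ^ 2 * m) :
    1 / 2 * Real.exp (m * (Real.binEntropy t - (Real.log t - Real.log (1 - t)) * δ)) ≤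
      (typicalBins m t δ).card := by
  have hsum := half_le_sum_typicalBins (by linarith) ht1 hδ hm
  rcases ht1.eq_or_lt with rfl | ht1
  -- At `t = 1` the convention `Real.log 0 = 0` makes the exponent zero, so one typical bin
  -- suffices.
  · have hne : (typicalBins m 1 δ).Nonempty := by
      by_contra hne
      rw [not_nonempty_iff_eq_empty.mp hne, sum_empty] at hsum
      norm_num at hsum
    have : (1 : ℝ) ≤ (typicalBins m 1 δ).card := by exact_mod_cast hne.card_pos
    simp
    linarith
  · have hlog : 0 ≤ Real.log t - Real.log (1 - t) :=
      sub_nonneg.mpr (Real.log_le_log (by linarith) (by linarith))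
    have hb : ∀ b ∈ typicalBins m t δ, iidBernoulli t b ≤
        Real.exp (-(m * (Real.binEntropy t - (Real.log t - Real.log (1 - t)) * δ))) := by
      intro b hb
      have hb' := le_of_abs_le (mem_filter.mp hb).2
      rw [iidBernoulli_eq_exp (by linarith) ht1 b t, Real.exp_le_exp, binEntropy_eq]
      nlinarith [mul_le_mul_of_nonneg_right hb' hlog]
    have h := hsum.trans (sum_le_card_nsmul _ _ _ hb)
    rw [nsmul_eq_mul, Real.exp_neg, ← div_eq_mul_inv, le_div_iff₀ (Real.exp_pos _)] at h
    exact h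

theorem le_inv_iidBernoulli_of_mem_typicalBins {p : ℝ} (hp0 : 0 < p) (hp : p ≤ 1 / 2) {m : ℕ}
    {t δ : ℝ} {b : Bin m} (hb : b ∈ typicalBins m t δ) :
    Real.exp (m * (-(t * Real.log p) - (1 - t) * Real.log (1 - p) -
      (Real.log (1 - p) - Real.log p) * δ)) ≤ (iidBernoulli p b)⁻¹ := by
  have hlog : 0 ≤ Real.log (1 - p) - Real.log p :=
    sub_nonneg.mpr (Real.log_le_log hp0 (by linarith))
  have hb' := neg_le_of_abs_le (mem_filter.mp hb).2
  rw [iidBernoulli_eq_exp hp0 (by linarith) b t, ← Real.exp_neg, Real.exp_le_exp]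
  nlinarith [mul_le_mul_of_nonneg_right hb' hlog]

/-- Each inverse probability is `(p (1 - p)) ^ (-m)` times the Bernoulli(`1 - p`) probability of the
same bin. -/
theorem sum_inv_iidBernoulli {p : ℝ} (hp0 : 0 < p) (hp1 : p < 1) (m : ℕ) :
    ∑ b : Bin m, (iidBernoulli p b)⁻¹ =
      Real.exp (m * (-Real.log p - Real.log (1 - p))) := by
  have h1p : 0 < 1 - p := by linarith
  have h : ∀ b : Bin m, (iidBernoulli p b)⁻¹ =
      Real.exp (m * (-Real.log p - Real.log (1 - p))) * iidBernoulli (1 - p) b := by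
    intro b
    rw [iidBernoulli_eq_exp hp0 hp1 b 0, iidBernoulli_eq_exp h1p (by linarith) b 0, ← Real.exp_neg,
      ← Real.exp_add, sub_sub_cancel]
    congr 1
    ring
  simp_rw [h]
  rw [← mul_sum, sum_iidBernoulli, mul_one]

theorem sum_inv_iidBernoulli_le {p s : ℝ} (hp0 : 0 < p) (hp : p ≤ 1 / 2) (hs : 1 - p ≤ s)
    (hs1 : s ≤ 1) {m : ℕ} (S : Finset (Bin m)) :
    ∑ b ∈ S, (iidBernoulli p b)⁻¹ ≤ (S.card + Real.exp (m * Real.binEntropy s)) *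
      Real.exp (m * (-(s * Real.log p) - (1 - s) * Real.log (1 - p))) := by
  set E := Real.exp (m * (-(s * Real.log p) - (1 - s) * Real.log (1 - p))) with hE
  have ha : 0 ≤ Real.log (1 - p) - Real.log p :=
    sub_nonneg.mpr (Real.log_le_log hp0 (by linarith))
  have hq : ∀ b : Bin m, (iidBernoulli p b)⁻¹ =
      E * Real.exp ((weight b - s * m) * (Real.log (1 - p) - Real.log p)) := by
    intro b
    rw [iidBernoulli_eq_exp hp0 (by linarith) b s, ← Real.exp_neg, hE, ← Real.exp_add]
    congr 1
    ring
  -- Up to weight `s * m` the summand 1 suffices. Above it, `s ≥ 1 - p` makes the log-probability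
  -- under Bernoulli(`s`) grow with the weight at least as fast as `-log` of the Bernoulli(`p`)
  -- probability.
  have hpt : ∀ b : Bin m, (iidBernoulli p b)⁻¹ ≤
      E * (1 + Real.exp (m * Real.binEntropy s) * iidBernoulli s b) := by
    intro b
    have hnn := mul_nonneg (Real.exp_pos (m * Real.binEntropy s)).le
      (iidBernoulli_nonneg (by linarith) hs1 b)
    rw [hq]
    refine mul_le_mul_of_nonneg_left ?_ (Real.exp_pos _).le
    rcases le_or_gt (weight b : ℝ) (s * m) with hw | hw
    · have : Real.exp ((weight b - s * m) * (Real.log (1 - p) - Real.log p)) ≤ 1 :=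
        Real.exp_le_one_iff.mpr (mul_nonpos_of_nonpos_of_nonneg (by linarith) ha)
      linarith
    · have hs1' : s < 1 := by
        refine lt_of_le_of_ne hs1 ?_
        rintro rfl
        have : (weight b : ℝ) ≤ m := by exact_mod_cast weight_le b
        linarith
      have hal : Real.log (1 - p) - Real.log p ≤ Real.log s - Real.log (1 - s) :=
        sub_le_sub (Real.log_le_log (by linarith) hs) (Real.log_le_log (by linarith) (by linarith))
      have : Real.exp ((weight b - s * m) * (Real.log (1 - p) - Real.log p)) ≤
          Real.exp (m * Real.binEntropy s) * iidBernoulli s b := by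
        rw [iidBernoulli_eq_exp (by linarith) hs1' b s, ← Real.exp_add, Real.exp_le_exp,
          binEntropy_eq]
        nlinarith [mul_le_mul_of_nonneg_left hal (sub_pos.mpr hw).le]
      linarith
  calc ∑ b ∈ S, (iidBernoulli p b)⁻¹
      ≤ ∑ b ∈ S, E * (1 + Real.exp (m * Real.binEntropy s) * iidBernoulli s b) :=
        sum_le_sum fun b _ => hpt b
    _ = E * (S.card + Real.exp (m * Real.binEntropy s) * ∑ b ∈ S, iidBernoulli s b) := by
        rw [← mul_sum, sum_add_distrib, sum_const, nsmul_one, mul_sum]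
    _ ≤ E * (S.card + Real.exp (m * Real.binEntropy s) * 1) := by
        gcongr
        rw [← sum_iidBernoulli s m]
        exact sum_le_sum_of_subset_of_nonneg (subset_univ _) fun b _ _ =>
          iidBernoulli_nonneg (by linarith) hs1 b
    _ = _ := by ring

/-- Allocating the least likely bins makes the sum of the inverse fractions large. -/
theorem IsLeastLikelyAllocation.le_sum_inv {m M : ℕ} {P : Bin m → ℝ} {β : Fin M → Bin m}
    (hβ : IsLeastLikelyAllocation P β) (hP : ∀ b, 0 < P b) {T : Finset (Bin m)} {K C : ℝ}
    (hC : 0 ≤ C) (hKT : K ≤ T.card) (hKM : K ≤ M) (hT : ∀ b ∈ T, C ≤ (P b)⁻¹) :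
    K * C ≤ ∑ i, (P (β i))⁻¹ := by
  have hnn : ∀ b, 0 ≤ (P b)⁻¹ := fun b => (inv_pos.mpr (hP b)).le
  -- Otherwise some allocated bin is likelier than every bin of `T`, which forces all of `T` to be
  -- allocated.
  by_cases hall : ∀ i, C ≤ (P (β i))⁻¹
  · calc K * C ≤ M * C := by gcongr
      _ = ∑ _i : Fin M, C := by simp
      _ ≤ _ := sum_le_sum fun i _ => hall i
  · push Not at hall
    obtain ⟨i, hi⟩ := hall
    have hsub : T ⊆ univ.image β := by
      intro b hb
      by_contra hb'
      have h1 := hβ.2.2 i b (by simpa using hb')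
      have h2 := inv_anti₀ (hP _) h1
      linarith [hT b hb]
    calc K * C ≤ T.card * C := by gcongr
      _ = ∑ _b ∈ T, C := by simp
      _ ≤ ∑ b ∈ T, (P b)⁻¹ := sum_le_sum hT
      _ ≤ ∑ b ∈ univ.image β, (P b)⁻¹ :=
        sum_le_sum_of_subset_of_nonneg hsub fun b _ _ => hnn b
      _ = _ := sum_image fun i _ j _ hij => hβ.1 hij

/-! ### Growth rate, number of users and limits -/

open Filter

/-- The claimed growth rate in nats, `t` being the dominating fraction of ones. -/
noncomputable def natRate (p s : ℝ) : ℝ :=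
  Real.binEntropy (max s (1 - p)) - Real.binEntropy s - max s (1 - p) * Real.log p -
    (1 - max s (1 - p)) * Real.log (1 - p)

theorem divergence_mul_log_two {q p : ℝ} (hq : 0 < q) (hp0 : 0 < p) (hp1 : p < 1) :
    divergence q p * Real.log 2 =
      q * (Real.log q - Real.log p) + (1 - q) * (Real.log (1 - q) - Real.log (1 - p)) := by
  have h2 : Real.log 2 ≠ 0 := (Real.log_pos one_lt_two).ne'
  rw [divergence, Real.logb, Real.logb, Real.log_div hq.ne' hp0.ne', add_mul, mul_assoc, mul_assoc,
    div_mul_cancel₀ _ h2, div_mul_cancel₀ _ h2]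
  by_cases h : 1 - q = 0
  · simp [h]
  · rw [Real.log_div h (by linarith)]

theorem entropy_mul_log_two (x : ℝ) : entropy x * Real.log 2 = Real.binEntropy x :=
  div_mul_cancel₀ _ (Real.log_pos one_lt_two).ne'

theorem onlineRate_eq {p s : ℝ} (hp0 : 0 < p) (hp : p ≤ 1 / 2) (hs : 1 / 2 ≤ s) :
    onlineRate p s = natRate p s / Real.log 2 := by
  have h2 : Real.log 2 ≠ 0 := (Real.log_pos one_lt_two).ne'
  rw [eq_div_iff h2, onlineRate, natRate]
  split_ifs with h
  · rw [max_eq_left h, add_mul, entropy_mul_log_two,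
      divergence_mul_log_two (by linarith) hp0 (by linarith), binEntropy_eq]
    ring
  · rw [max_eq_right (not_le.mp h).le, sub_mul, add_mul, mul_assoc, entropy_mul_log_two,
      entropy_mul_log_two, divergence_mul_log_two (by linarith) hp0 (by linarith),
      Real.binEntropy_one_sub, binEntropy_eq p, sub_sub_cancel]
    ring

theorem two_rpow_entropy (s : ℝ) (m : ℕ) :
    (2 : ℝ) ^ (entropy s * m - 1) = Real.exp (m * Real.binEntropy s) / 2 := by
  rw [Real.rpow_sub_one two_ne_zero, Real.rpow_def_of_pos two_pos, ← entropy_mul_log_two]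
  congr 2
  ring

theorem numUsers_le {s : ℝ} (hs0 : 0 ≤ s) (hs1 : s ≤ 1) (m : ℕ) :
    (numUsers s m : ℝ) ≤ Real.exp (m * Real.binEntropy s) := by
  rw [numUsers, two_rpow_entropy, Nat.cast_max, Nat.cast_one]
  refine max_le ?_ ((Nat.floor_le (by positivity)).trans (half_le_self (Real.exp_pos _).le))
  exact Real.one_le_exp (mul_nonneg m.cast_nonneg (Real.binEntropy_nonneg hs0 hs1))

/-- Twice the maximum of 1 and a floor is at least the floor plus one; this accounts for 1/4 in
place of 1/2. -/
theorem le_numUsers (s : ℝ) (m : ℕ) :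
    1 / 4 * Real.exp (m * Real.binEntropy s) ≤ numUsers s m := by
  rw [numUsers, two_rpow_entropy, Nat.cast_max, Nat.cast_one]
  have := Nat.lt_floor_add_one (Real.exp (m * Real.binEntropy s) / 2)
  have h1 := le_max_left (1 : ℝ) (⌊Real.exp (m * Real.binEntropy s) / 2⌋₊ : ℝ)
  have h2 := le_max_right (1 : ℝ) (⌊Real.exp (m * Real.binEntropy s) / 2⌋₊ : ℝ)
  linarith

instance (s : ℝ) (m : ℕ) : NeZero (numUsers s m) :=
  ⟨(lt_of_lt_of_le one_pos (le_max_left _ _)).ne'⟩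

theorem tendsto_logb_div {F : ℕ → ℝ} {R : ℝ}
    (hup : ∃ C > 0, ∀ᶠ m : ℕ in atTop, F m ≤ C * Real.exp (m * R))
    (hlo : ∀ η > 0, ∃ c > 0, ∀ᶠ m : ℕ in atTop, c * Real.exp (m * (R - η)) ≤ F m) :
    Tendsto (fun m : ℕ => 1 / (m : ℝ) * Real.logb 2 (F m)) atTop (𝓝 (R / Real.log 2)) := by
  have hmain : Tendsto (fun m : ℕ => Real.log (F m) / m) atTop (𝓝 R) := by
    rw [tendsto_order]
    constructor
    · intro a ha
      obtain ⟨c, hc, hF⟩ := hlo ((R - a) / 2) (by linarith)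
      have hlim : ∀ᶠ m : ℕ in atTop, (a - R) / 2 < Real.log c / m :=
        (tendsto_const_div_atTop_nhds_zero_nat (Real.log c)).eventually_const_lt (by linarith)
      filter_upwards [hF, hlim, eventually_gt_atTop 0] with m hm hm' hm0
      have hm0' : (0 : ℝ) < m := by exact_mod_cast hm0
      have h := Real.log_le_log (by positivity) hm
      rw [Real.log_mul hc.ne' (Real.exp_pos _).ne', Real.log_exp] at h
      rw [lt_div_iff₀ hm0'] at hm' ⊢
      nlinarith
    · intro a ha
      obtain ⟨C, hC, hF⟩ := hup
      -- The lower bound is used here only for positivity of `F m`, needed for monotonicity of the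
      -- logarithm.
      obtain ⟨c, hc, hF'⟩ := hlo 1 one_pos
      have hlim : ∀ᶠ m : ℕ in atTop, Real.log C / m < a - R :=
        (tendsto_const_div_atTop_nhds_zero_nat (Real.log C)).eventually_lt_const (by linarith)
      filter_upwards [hF, hF', hlim, eventually_gt_atTop 0] with m hm hmc hm' hm0
      have hm0' : (0 : ℝ) < m := by exact_mod_cast hm0
      have h := Real.log_le_log (lt_of_lt_of_le (by positivity) hmc) hm
      rw [Real.log_mul hC.ne' (Real.exp_pos _).ne', Real.log_exp] at h
      rw [div_lt_iff₀ hm0'] at hm' ⊢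
      linarith
  refine (hmain.div_const (Real.log 2)).congr fun m => ?_
  rw [Real.logb]
  ring

theorem pow_le_iidBernoulli {p : ℝ} (hp0 : 0 < p) (hp : p ≤ 1 / 2) {m : ℕ} (b : Bin m) :
    p ^ m ≤ iidBernoulli p b := by
  rw [iidBernoulli_eq_pow]
  calc p ^ m = p ^ weight b * p ^ (m - weight b) := by
        rw [← pow_add, Nat.add_sub_cancel' (weight_le b)]
    _ ≤ _ := by
        gcongr
        linarith

/-- The surplus `ε` in `n` eventually pays for the factor 5. That factor absorbs the rounding error
1 and leaves `4 exp (m H(s)) ≥ 2 (M + 1)`. -/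
theorem eventually_mappings_large {p s ε : ℝ} (hp0 : 0 < p) (hp : p ≤ 1 / 2) (hs0 : 0 ≤ s)
    (hs1 : s ≤ 1) (hε : 0 < ε) {n : ℕ → ℕ}
    (hn : ∀ m : ℕ, (1 + ε) * m * (Real.logb 2 (1 / p) + entropy s) ≤ n m) :
    ∀ᶠ m : ℕ in atTop, ∀ b : Bin m,
      5 * Real.exp (m * Real.binEntropy s) ≤ 2 ^ n m * iidBernoulli p b := by
  have hl2 : 0 < Real.log 2 := Real.log_pos one_lt_two
  have hlp : Real.log 2 ≤ -Real.log p := by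
    rw [← Real.log_inv]
    refine Real.log_le_log two_pos ?_
    rw [le_inv_comm₀ two_pos hp0]
    linarith
  have hH := Real.binEntropy_nonneg hs0 hs1
  have hlim : Tendsto (fun m : ℕ => (m : ℝ) * (ε * Real.log 2)) atTop atTop :=
    tendsto_natCast_atTop_atTop.atTop_mul_const (by positivity)
  filter_upwards [hlim.eventually_ge_atTop (Real.log 5)] with m hm b
  have hnm := mul_le_mul_of_nonneg_right (hn m) hl2.le
  rw [mul_assoc, add_mul (Real.logb 2 (1 / p)), entropy_mul_log_two, Real.logb, div_mul_cancel₀ _ hl2.ne', one_div,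
    Real.log_inv] at hnm
  calc 5 * Real.exp (m * Real.binEntropy s)
      = Real.exp (Real.log 5 + m * Real.binEntropy s) := by
        rw [Real.exp_add, Real.exp_log (by norm_num)]
    _ ≤ Real.exp (n m * Real.log 2 + m * Real.log p) := by
        rw [Real.exp_le_exp]
        have h1 : 0 ≤ ε * m * Real.binEntropy s := by positivity
        have h2 : ε * m * Real.log 2 ≤ ε * m * -Real.log p := by gcongr
        linarith
    _ = 2 ^ n m * p ^ m := by
        rw [Real.exp_add, Real.exp_nat_mul, Real.exp_nat_mul, Real.exp_log two_pos,
          Real.exp_log hp0]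
    _ ≤ _ := by
        gcongr
        exact pow_le_iidBernoulli hp0 hp b

theorem half_iidBernoulli_le_and_le {n m : ℕ} {p s : ℝ} {P : Bin m → ℝ}
    (hs0 : 0 ≤ s) (hs1 : s ≤ 1) (hP : RepresentsIIDBernoulli n p P)
    (hlarge : ∀ b : Bin m, 5 * Real.exp (m * Real.binEntropy s) ≤ 2 ^ n * iidBernoulli p b)
    (b : Bin m) :
    2 * (numUsers s m + 1 : ℝ) ≤ 2 ^ n * P b ∧ iidBernoulli p b / 2 ≤ P b ∧
      P b ≤ 2 * iidBernoulli p b := by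
  have hN : (0 : ℝ) < 2 ^ n := by positivity
  have h1 : 1 ≤ Real.exp (m * Real.binEntropy s) :=
    Real.one_le_exp (mul_nonneg m.cast_nonneg (Real.binEntropy_nonneg hs0 hs1))
  have hM := numUsers_le hs0 hs1 m
  have hb := hlarge b
  have habs := abs_lt.mp (hP.2 b)
  refine ⟨by linarith, le_of_mul_le_mul_left ?_ hN, le_of_mul_le_mul_left ?_ hN⟩ <;> linarith

/-! ### Exponent of the average inverse fraction -/

/-- For `s ≥ 1 - p` the sum over the allocated bins is compared with Bernoulli(`s`); otherwise it is
enlarged to all bins. The constant is `2 (1 + 4)`: 2 from rounding, 4 from `exp (m H(s)) ≤ 4 M`. -/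
theorem expect_inv_le {m : ℕ} {p s : ℝ} {P : Bin m → ℝ} (hp0 : 0 < p) (hp : p ≤ 1 / 2)
    (hs1 : s ≤ 1) {β : Fin (numUsers s m) → Bin m} (hβ : Function.Injective β)
    (hP : ∀ b, iidBernoulli p b / 2 ≤ P b) :
    𝔼 i, (P (β i))⁻¹ ≤ 10 * Real.exp (m * natRate p s) := by
  have hMpos : (0 : ℝ) < numUsers s m := by exact_mod_cast NeZero.pos (numUsers s m)
  have hq : ∀ b : Bin m, 0 < iidBernoulli p b := fun b =>
    (pow_pos hp0 m).trans_le (pow_le_iidBernoulli hp0 hp b)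
  have hM := le_numUsers s m
  have hsum : ∑ i, (P (β i))⁻¹ ≤ 2 * ∑ b ∈ univ.image β, (iidBernoulli p b)⁻¹ := by
    rw [sum_image fun i _ j _ hij => hβ hij, mul_sum]
    refine sum_le_sum fun i _ => (inv_anti₀ (half_pos (hq _)) (hP _)).trans ?_
    rw [inv_div, div_eq_mul_inv]
  rw [Fintype.expect_eq_sum_div_card, Fintype.card_fin, div_le_iff₀ hMpos]
  refine hsum.trans ?_
  rcases le_total (1 - p) s with h | h
  · have h1 := sum_inv_iidBernoulli_le hp0 hp h hs1 (univ.image β)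
    rw [card_image_of_injective _ hβ, card_univ, Fintype.card_fin] at h1
    have hr : natRate p s = -(s * Real.log p) - (1 - s) * Real.log (1 - p) := by
      rw [natRate, max_eq_left h]
      ring
    rw [← hr] at h1
    nlinarith [Real.exp_pos (m * natRate p s)]
  · have h1 : ∑ b ∈ univ.image β, (iidBernoulli p b)⁻¹ ≤ ∑ b, (iidBernoulli p b)⁻¹ :=
      sum_le_sum_of_subset_of_nonneg (subset_univ _) fun b _ _ => (inv_pos.mpr (hq b)).le
    have hr : -Real.log p - Real.log (1 - p) = natRate p s + Real.binEntropy s := by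
      rw [natRate, max_eq_right h, Real.binEntropy_one_sub, binEntropy_eq p]
      ring
    rw [sum_inv_iidBernoulli hp0 (by linarith), hr, mul_add, Real.exp_add] at h1
    nlinarith [Real.exp_pos (m * natRate p s)]

theorem le_expect_inv {p s η : ℝ} (hp0 : 0 < p) (hp : p ≤ 1 / 2) (hs : 1 / 2 ≤ s) (hs1 : s ≤ 1)
    (hη : 0 < η) :
    ∀ᶠ m : ℕ in atTop, ∀ (P : Bin m → ℝ) (β : Fin (numUsers s m) → Bin m),
      IsLeastLikelyAllocation P β → (∀ b, 0 < P b) → (∀ b, P b ≤ 2 * iidBernoulli p b) →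
        1 / 8 * Real.exp (m * (natRate p s - η)) ≤ 𝔼 i, (P (β i))⁻¹ := by
  set t := max s (1 - p) with ht
  have hst : s ≤ t := le_max_left _ _
  have ht1 : t ≤ 1 := max_le hs1 (by linarith)
  have ha : 0 ≤ Real.log (1 - p) - Real.log p :=
    sub_nonneg.mpr (Real.log_le_log hp0 (by linarith))
  have hl : 0 ≤ Real.log t - Real.log (1 - t) := by
    rcases ht1.eq_or_lt with h | h
    · simp [h]
    · exact sub_nonneg.mpr (Real.log_le_log (by linarith) (by linarith))
  -- `κ * δ` is the total loss in the exponent from the width `δ`, in the number of typical bins and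
  -- in their inverse probabilities. Dividing by `κ + 1` below also covers `κ = 0`.
  set κ := (Real.log t - Real.log (1 - t)) + (Real.log (1 - p) - Real.log p) with hκ
  have hκ0 : 0 ≤ κ := add_nonneg hl ha
  set δ := η / (κ + 1) with hδ
  have hδ0 : 0 < δ := by positivity
  have hκδ : κ * δ ≤ η := by
    rw [hδ, mul_div_assoc', div_le_iff₀ (by positivity)]
    nlinarith
  have hlim : Tendsto (fun m : ℕ => 2 * δ ^ 2 * (m : ℝ)) atTop atTop :=
    tendsto_natCast_atTop_atTop.const_mul_atTop (by positivity)
  filter_upwards [hlim.eventually_ge_atTop 1] with m hm P β hβ hP hPq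
  have hH : Real.binEntropy t ≤ Real.binEntropy s :=
    Real.binEntropy_strictAntiOn.antitoneOn ⟨by simpa using hs, hs1⟩
      ⟨by simpa using hs.trans hst, ht1⟩ hst
  have hMle := numUsers_le (by linarith) hs1 m
  have hMge := le_numUsers s m
  set E₁ := Real.exp (m * (Real.binEntropy t - (Real.log t - Real.log (1 - t)) * δ)) with hE₁
  set E₂ := Real.exp (m * (-(t * Real.log p) - (1 - t) * Real.log (1 - p) -
      (Real.log (1 - p) - Real.log p) * δ)) with hE₂
  have hcard : 1 / 2 * E₁ ≤ (typicalBins m t δ).card :=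
    le_card_typicalBins (hs.trans hst) ht1 hδ0 hm
  have hE₁le : E₁ ≤ Real.exp (m * Real.binEntropy s) := by
    rw [hE₁, Real.exp_le_exp]
    have := mul_nonneg hl hδ0.le
    gcongr
    linarith
  have hE₁pos : 0 < E₁ := Real.exp_pos _
  have hT : ∀ b ∈ typicalBins m t δ, 1 / 2 * E₂ ≤ (P b)⁻¹ := by
    intro b hb
    have h1 := le_inv_iidBernoulli_of_mem_typicalBins hp0 hp hb
    have h2 := inv_anti₀ (hP b) (hPq b)
    rw [mul_inv] at h2
    linarith
  -- Entropy decreases on `[1/2, 1]` and `t ≥ s`, so `E₁ ≤ exp (m H(s)) ≤ 4 M`; thus `E₁ / 4` is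
  -- below both `M` and the number of typical bins.
  have hsum := hβ.le_sum_inv hP (K := 1 / 4 * E₁) (by positivity) (by linarith) (by linarith) hT
  have hMpos : (0 : ℝ) < numUsers s m := by exact_mod_cast NeZero.pos (numUsers s m)
  rw [Fintype.expect_eq_sum_div_card, Fintype.card_fin, le_div_iff₀ hMpos]
  refine le_trans ?_ hsum
  calc 1 / 8 * Real.exp (m * (natRate p s - η)) * numUsers s m
      ≤ 1 / 8 * Real.exp (m * (natRate p s - η)) * Real.exp (m * Real.binEntropy s) := by gcongr
    _ = 1 / 8 * Real.exp (m * (natRate p s - η + Real.binEntropy s)) := by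
        rw [mul_assoc, ← Real.exp_add, mul_add]
    _ ≤ 1 / 8 * Real.exp (m * (Real.binEntropy t - t * Real.log p -
          (1 - t) * Real.log (1 - p) - κ * δ)) := by
        rw [natRate, ← ht]
        gcongr
        linarith
    _ = 1 / 4 * E₁ * (1 / 2 * E₂) := by
        rw [hE₁, hE₂, mul_mul_mul_comm, ← Real.exp_add, hκ]
        norm_num
        ring_nf

theorem tendsto_of_mem_Icc {p s ε : ℝ} (hp0 : 0 < p) (hp : p ≤ 1 / 2) (hs : 1 / 2 ≤ s)
    (hs1 : s ≤ 1) (hε : 0 < ε) {n : ℕ → ℕ}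
    (hn : ∀ m : ℕ, (1 + ε) * m * (Real.logb 2 (1 / p) + entropy s) ≤ n m)
    {P : ∀ m : ℕ, Bin m → ℝ} (hP : ∀ m, RepresentsIIDBernoulli (n m) p (P m))
    {β : ∀ m : ℕ, Fin (numUsers s m) → Bin m} (hβ : ∀ m, IsLeastLikelyAllocation (P m) (β m))
    {F : ℕ → ℝ}
    (hF : ∀ m, (∀ b, 2 * (numUsers s m + 1 : ℝ) ≤ 2 ^ n m * P m b) →
      F m ∈ Set.Icc ((1 / 2) * 𝔼 i, (P m (β m i))⁻¹) (3 * 𝔼 i, (P m (β m i))⁻¹)) :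
    Tendsto (fun m : ℕ => 1 / (m : ℝ) * Real.logb 2 (F m)) atTop (𝓝 (onlineRate p s)) := by
  have hlarge := eventually_mappings_large hp0 hp (by linarith : 0 ≤ s) hs1 hε hn
  rw [onlineRate_eq hp0 hp hs]
  refine tendsto_logb_div ⟨30, by norm_num, ?_⟩ fun η hη => ⟨1 / 16, by norm_num, ?_⟩
  · filter_upwards [hlarge] with m hm
    have hb := half_iidBernoulli_le_and_le (by linarith) hs1 (hP m) hm
    have h1 := (hF m fun b => (hb b).1).2
    have h2 := expect_inv_le hp0 hp hs1 (hβ m).1 fun b => (hb b).2.1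
    linarith
  · filter_upwards [hlarge, le_expect_inv hp0 hp hs hs1 hη] with m hm hm'
    have hb := half_iidBernoulli_le_and_le (by linarith) hs1 (hP m) hm
    have h1 := (hF m fun b => (hb b).1).1
    have h2 := hm' (P m) (β m) (hβ m)
      (fun b => (half_pos ((pow_pos hp0 m).trans_le (pow_le_iidBernoulli hp0 hp b))).trans_le
        (hb b).2.1) fun b => (hb b).2.2
    linarith

theorem averageOverStrategies_mem_Icc {n m M : ℕ} [NeZero M] {h : HashFun n m} {P : Bin m → ℝ}
    (hh : fractions h = P) {β : Fin M → Bin m} (hβ : IsLeastLikelyAllocation P β)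
    (hM : ∀ b, 2 * (M + 1 : ℝ) ≤ 2 ^ n * P b) :
    averageOverStrategies h β ∈
      Set.Icc ((1 / 2) * 𝔼 i, (P (β i))⁻¹) (3 * 𝔼 i, (P (β i))⁻¹) :=
  ⟨le_averageOverStrategies hh hβ hM, averageOverStrategies_le hh hM⟩

end Guesswork

theorem mainTheorem1 (p s ε : ℝ) (hp0 : 0 < p) (hp : p ≤ 1 / 2) (hs : 1 / 2 ≤ s) (hs1 : s ≤ 1)
    (hε : 0 < ε) (n : ℕ → ℕ)
    (hn : ∀ m : ℕ, (1 + ε) * m * (Real.logb 2 (1 / p) + Guesswork.entropy s) ≤ n m)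
    (P : ∀ m : ℕ, Guesswork.Bin m → ℝ)
    (hP : ∀ m, Guesswork.RepresentsIIDBernoulli (n m) p (P m))
    (β : ∀ m : ℕ, Fin (Guesswork.numUsers s m) → Guesswork.Bin m)
    (hβ : ∀ m, Guesswork.IsLeastLikelyAllocation (P m) (β m)) :
    (∀ h : ∀ m : ℕ, Guesswork.HashFun (n m) m, (∀ m, Guesswork.fractions (h m) = P m) →
      Filter.Tendsto
        (fun m : ℕ => 1 / (m : ℝ) * Real.logb 2 (Guesswork.averageOverStrategies (h m) (β m)))
        Filter.atTop (𝓝 (Guesswork.onlineRate p s))) ∧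
    (∀ σ : ∀ m : ℕ, Guesswork.Strategy (n m),
      Filter.Tendsto
        (fun m : ℕ => 1 / (m : ℝ) * Real.logb 2 (Guesswork.averageOverHashSet (P m) (β m) (σ m)))
        Filter.atTop (𝓝 (Guesswork.onlineRate p s))) := by
  refine ⟨fun h hh => ?_, fun σ => ?_⟩
  · exact Guesswork.tendsto_of_mem_Icc hp0 hp hs hs1 hε hn hP hβ fun m hM =>
      Guesswork.averageOverStrategies_mem_Icc (hh m) (hβ m) hM
  · exact Guesswork.tendsto_of_mem_Icc hp0 hp hs hs1 hε hn hP hβ fun m hM =>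
      Guesswork.averageOverHashSet_mem_Icc (hP m).1
        (fun h hh => Guesswork.averageOverStrategies_mem_Icc hh (hβ m) hM) (σ m)
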